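/- All vector spaces are over the field $\mathbb F_2$ with two elements. For a quadratic map $q:V\to W$ let $b_q(v,u)=q(v+u)-q(v)-q(u)$ be its polar map; $q$ is regular if $b_q(v,u)=0$ for all $u$ implies $v=0$. A special $2$-group is a finite non-commutative $2$-group $G$ with $[G,G]=\Phi(G)=Z(G)=\Omega(Z(G))$, where $\Phi$ is the Frattini subgroup and $\Omega(Z(G))$ is the subgroup generated by the $x \in Z(G)$ with $x^2=1$. It is the special $2$-group associated with $q$ if, under group isomorphisms $G/Z(G)\cong V$ and $Z(G)\cong W$, the map $G/Z(G)\to Z(G)$, $xZ(G)\mapsto x^2$, becomes $q$. A group is strongly real if each of its elements is a product of two elements $a,b$ with $a^2=b^2=1$. A group is real if each element is conjugate to its inverse; a finite real group is totally orthogonal if it has no symplectic representation, i.e. if every irreducible complex representation of it is realizable over $\mathbb R$. We write $[a,b]$ for the form $ax^2+xy+by^2$. The Arf invariant of a regular quadratic form $Q$ over a field $F$ of characteristic $2$ is the class of $\sum_i Q(e_i)Q(f_i)$ in $F/\{t^2+t : t\in F\}$, for any symplectic basis $(e_i,f_i)$ of $b_Q$. Let $V=\mathbb F_2^4$, $W=\mathbb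 F_2^2$ and $$q:V\to W,\qquad q(w,x,y,z)=(z^2+wx+wz+xy,\;wy).$$ 1. The quadratic map $q$ is regular and the image of $b_q$ generates $W$. A special $2$-group associated with $q$ exists, and every special $2$-group $G$ associated with $q$ has order $64$, is strongly real, and is not totally orthogonal. 2. For every nonzero $v\in V$ the following table gives an element $a\in V$ with $a\ne v$ and $q(a)=q(a-v)=0$: $$\begin{array}{c|c} v & a\\ \hline (1,0,0,0),(0,1,0,0),(0,0,1,0),(1,0,0,1),(0,1,1,1) & (0,0,0,0)\\ (0,0,0,1),(1,1,0,0),(1,0,1,0),(1,1,1,1) & (1,0,0,0)\\ (0,1,1,0),(0,1,0,1) & (0,0,1,0)\\ (0,0,1,1) & (0,1,0,0)\\ (1,1,1,0),(1,0,1,1),(1,1,0,1) & (1,0,0,1) \end{array}$$ 3. Let $s:W\to\mathbb F_2$, $s(w_1,w_2)=w_1+w_2$. The transfer $s_*(q)=s\circ q$, that is $s_*(q)(w,x,y,z)=z^2+wx+wz+xy+wy$, is a regular quadratic form, so that it is isometric to the form $q_s$ which it induces on the quotient of $V$ by the radical of its polar form. The substitution $w\mapsto w+x+z$, $x\mapsto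 x+y$, $y\mapsto y+w$, $z\mapsto y+z$ turns $s_*(q)$ into the form $[1,1]\perp[0,0]$ in the pairs of variables $(w,x)$ and $(y,z)$; so $s_*(q)$ is isometric to $[1,1]\perp[0,0]$. The Arf invariant of $[1,1]\perp[0,0]$, and hence that of $s_*(q)$, is nontrivial. -/

import Mathlib

universe u

namespace SpecialTwoGroups

section Groups

variable (G : Type u) [Group G]

/-- Every element is conjugate to its inverse. -/
def IsRealGroup : Prop :=
  ∀ x : G, IsConj x x⁻¹

/-- Every element is a product of two self-inverse elements. -/
def IsStronglyReal : Prop :=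
  ∀ x : G, ∃ a b : G, a ^ 2 = 1 ∧ b ^ 2 = 1 ∧ x = a * b

/-- The subgroup `Ω(Z(G))` of `G` generated by the central elements `x` with `x ^ 2 = 1`. -/
def omegaCenter : Subgroup G :=
  Subgroup.closure {x : G | x ∈ Subgroup.center G ∧ x ^ 2 = 1}

/-- A special `2`-group: a finite non-commutative `2`-group with
`G' = Φ(G) = Z(G) = Ω(Z(G))`. -/
structure IsSpecialTwoGroup : Prop where
  finite : Finite G
  isTwoGroup : IsPGroup 2 G
  noncomm : ∃ x y : G, x * y ≠ y * x
  commutator_eq_frattini : commutator G = frattini G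
  frattini_eq_center : frattini G = Subgroup.center G
  center_eq_omega : Subgroup.center G = omegaCenter G

variable {G}

/-- A complex representation is realizable over `ℝ` if, in a suitable basis, all its matrices have
real entries. -/
def IsRealizableOverReal {V : Type*} [AddCommGroup V] [Module ℂ V]
    (ρ : Representation ℂ G V) : Prop :=
  ∃ (n : ℕ) (b : Module.Basis (Fin n) ℂ V), ∀ (g : G) (i j : Fin n),
    ∃ r : ℝ, LinearMap.toMatrix b b (ρ g) i j = (r : ℂ)

/-- For a real group `G`: the symplectic representations are the irreducible complex
representations that are not realizable over `ℝ`. -/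
def IsSymplecticRep {V : Type*} [AddCommGroup V] [Module ℂ V]
    (ρ : Representation ℂ G V) : Prop :=
  ρ.IsIrreducible ∧ ¬ IsRealizableOverReal ρ

variable (G)

/-- A real group without symplectic representations. Every finite-dimensional complex
representation is isomorphic to one on some `ℂⁿ`, so it is enough to look at those. -/
def IsTotallyOrthogonal : Prop :=
  IsRealGroup G ∧
    ∀ (n : ℕ) (ρ : Representation ℂ G (Fin n → ℂ)), ¬ IsSymplecticRep ρ

end Groups

section QuadraticMaps

/-- A quadratic map is regular if the radical of its polar map is zero. -/
def IsRegular {F V W : Type*} [CommRing F] [AddCommGroup V] [Module F V]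
    [AddCommGroup W] [Module F W] (q : QuadraticMap F V W) : Prop :=
  ∀ v : V, (∀ u : V, QuadraticMap.polar q v u = 0) → v = 0

/-- `G` is a special `2`-group whose associated quadratic map `G/Z(G) → Z(G)`, `xZ(G) ↦ x ^ 2`, is
`q`, under identifications of `G/Z(G)` with `V` and of `Z(G)` with `W`. -/
def IsSpecialTwoGroupOf (G : Type u) [Group G] {V W : Type*} [AddCommGroup V] [Module (ZMod 2) V]
    [AddCommGroup W] [Module (ZMod 2) W] (q : QuadraticMap (ZMod 2) V W) : Prop :=
  IsSpecialTwoGroup G ∧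
    ∃ (eV : G ⧸ Subgroup.center G ≃* Multiplicative V)
      (eW : Multiplicative W ≃* Subgroup.center G),
      ∀ x : G, (eW (Multiplicative.ofAdd (q (Multiplicative.toAdd (eV (x : G ⧸ Subgroup.center G)))))
        : G) = x ^ 2

/-- The transfer `s_*(q) = s ∘ q` of `q` by the linear form `s`. -/
def transfer {F V W : Type*} [CommRing F] [AddCommGroup V] [Module F V]
    [AddCommGroup W] [Module F W] (s : W →ₗ[F] F) (q : QuadraticMap F V W) : QuadraticForm F V :=
  s.compQuadraticMap q

/-- If `Q` vanishes on the radical of its polar form, the form induced by `Q` on the quotient of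
`V` by that radical. -/
def inducedForm {F V : Type*} [CommRing F] [AddCommGroup V] [Module F V] (Q : QuadraticForm F V)
    (h : LinearMap.ker (QuadraticMap.polarBilin Q) ≤ Q.radical) :
    QuadraticForm F (V ⧸ LinearMap.ker (QuadraticMap.polarBilin Q)) :=
  Q.lift _ h

/-- The form `[a, b]`, that is `(x, y) ↦ a x² + x y + b y²`. -/
def binaryForm {F : Type*} [CommRing F] (a b : F) : QuadraticForm F (F × F) :=
  a • QuadraticMap.linMulLin (LinearMap.fst F F F) (LinearMap.fst F F F)
    + QuadraticMap.linMulLin (LinearMap.fst F F F) (LinearMap.snd F F F)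
    + b • QuadraticMap.linMulLin (LinearMap.snd F F F) (LinearMap.snd F F F)

theorem binaryForm_apply {F : Type*} [CommRing F] (a b x y : F) :
    binaryForm a b (x, y) = a * x ^ 2 + x * y + b * y ^ 2 := by
  simp [binaryForm]
  ring

/-- The additive subgroup `℘(F) = {x² + x}` of a field of characteristic two. -/
def artinSchreierSubgroup (F : Type*) [Field F] [CharP F 2] : AddSubgroup F where
  carrier := {c | ∃ x : F, c = x ^ 2 + x}
  zero_mem' := ⟨0, by simp⟩
  add_mem' := by
    rintro _ _ ⟨x, rfl⟩ ⟨y, rfl⟩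
    refine ⟨x + y, ?_⟩
    rw [CharTwo.add_sq]
    ring
  neg_mem' := by
    rintro _ ⟨x, rfl⟩
    exact ⟨x, CharTwo.neg_eq _⟩

/-- A symplectic basis for the polar form of `Q`: vectors `e i = b (inl i)`, `f i = b (inr i)`. -/
def IsSymplecticBasis {F V : Type*} [Field F] [AddCommGroup V] [Module F V]
    (Q : QuadraticForm F V) {n : ℕ} (b : Module.Basis (Fin n ⊕ Fin n) F V) : Prop :=
  ∀ i j : Fin n,
    QuadraticMap.polar Q (b (Sum.inl i)) (b (Sum.inl j)) = 0 ∧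
    QuadraticMap.polar Q (b (Sum.inr i)) (b (Sum.inr j)) = 0 ∧
    QuadraticMap.polar Q (b (Sum.inl i)) (b (Sum.inr j)) = if i = j then 1 else 0

open scoped Classical in
/-- The Arf invariant in `F/℘(F)` of a regular quadratic form: the class of `∑ Q(eᵢ) Q(fᵢ)` for a
symplectic basis. The class does not depend on the basis. Forms without a symplectic
basis (those that are not regular) get the trivial class. -/
noncomputable def arfInvariant {F V : Type*} [Field F] [CharP F 2] [AddCommGroup V] [Module F V]
    (Q : QuadraticForm F V) : F ⧸ artinSchreierSubgroup F :=
  if h : ∃ (n : ℕ) (b : Module.Basis (Fin n ⊕ Fin n) F V), IsSymplecticBasis Q b then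
    QuotientAddGroup.mk
      (∑ i, Q (h.choose_spec.choose (Sum.inl i)) * Q (h.choose_spec.choose (Sum.inr i)))
  else 0

end QuadraticMaps

section TheMap

/-- The quadratic map `q(w, x, y, z) = (z² + wx + wz + xy, wy)` from `𝔽₂⁴` to `𝔽₂²`. -/
def qMap : QuadraticMap (ZMod 2) (Fin 4 → ZMod 2) (Fin 2 → ZMod 2) :=
  QuadraticMap.ofPolar
    (fun v => ![v 3 ^ 2 + v 0 * v 1 + v 0 * v 3 + v 1 * v 2, v 0 * v 2])
    (by
      intro a v
      ext i
      fin_cases i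
      · change (a * v 3) ^ 2 + a * v 0 * (a * v 1) + a * v 0 * (a * v 3) + a * v 1 * (a * v 2)
          = a * a * (v 3 ^ 2 + v 0 * v 1 + v 0 * v 3 + v 1 * v 2)
        ring
      · change a * v 0 * (a * v 2) = a * a * (v 0 * v 2)
        ring)
    (by
      intro v v' u
      ext i
      fin_cases i <;> simp [QuadraticMap.polar] <;> ring)
    (by
      intro a v u
      ext i
      fin_cases i <;> simp [QuadraticMap.polar] <;> ring)

theorem qMap_apply (w x y z : ZMod 2) :
    qMap ![w, x, y, z] = ![z ^ 2 + w * x + w * z + x * y, w * y] := rfl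

/-- The linear form `s(w₁, w₂) = w₁ + w₂` on `𝔽₂²`. -/
def sMap : (Fin 2 → ZMod 2) →ₗ[ZMod 2] ZMod 2 :=
  (LinearMap.proj 0 : (Fin 2 → ZMod 2) →ₗ[ZMod 2] ZMod 2) + LinearMap.proj 1

/-- A table of pairs `(v, a)`. -/
def table : List ((Fin 4 → ZMod 2) × (Fin 4 → ZMod 2)) :=
  [(![1, 0, 0, 0], ![0, 0, 0, 0]), (![0, 1, 0, 0], ![0, 0, 0, 0]),
   (![0, 0, 1, 0], ![0, 0, 0, 0]), (![1, 0, 0, 1], ![0, 0, 0, 0]),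
   (![0, 1, 1, 1], ![0, 0, 0, 0]),
   (![0, 0, 0, 1], ![1, 0, 0, 0]), (![1, 1, 0, 0], ![1, 0, 0, 0]),
   (![1, 0, 1, 0], ![1, 0, 0, 0]), (![1, 1, 1, 1], ![1, 0, 0, 0]),
   (![0, 1, 1, 0], ![0, 0, 1, 0]), (![0, 1, 0, 1], ![0, 0, 1, 0]),
   (![0, 0, 1, 1], ![0, 1, 0, 0]),
   (![1, 1, 1, 0], ![1, 0, 0, 1]), (![1, 0, 1, 1], ![1, 0, 0, 1]),
   (![1, 1, 0, 1], ![1, 0, 0, 1])]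

end TheMap

end SpecialTwoGroups

/-! ### Special 2-groups as central extensions with a bilinear cocycle. -/

namespace SpecialTwoGroups

/-! Existence: write q(v) = B(v, v) with B bilinear, and give V × W the group law with cocycle B.
Squares are then the values of q and commutators those of its polar map. Regularity makes W the
whole centre, and W is the commutator subgroup because the polar values generate it
(`isSpecialTwoGroupOf`).

Strong reality: if x lies above v and g above a, then x = g · g⁻¹x, and the two factors have squares
q(a) and q(a - v); the table makes both vanish.

Failure of total orthogonality: take an irreducible ρ whose central character is (-1)^s
(`exists_irreducible_of_centralCharacter`). Then ρ(x)² = ±1 with the sign given by s_*(q), hence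
ρ(x) and ρ(y) commute up to the sign given by its polar form. As s_*(q) is [1,1] ⊥ [0,0], four
elements of G act through the relations of ℍ ⊗ M₂. A nonzero complex module over these relations
contains an invariant subspace of dimension at most 4 (`exists_invariant_submodule`), which is
stable under G, so dim ρ ≤ 4. A nonzero real module has dimension at least 8 (`eight_le_finrank`),
since ℍ is a division algebra. So ρ has no real form.

Arf invariant: a four-dimensional regular form over 𝔽₂ has 10 zeros if its Arf invariant is trivial
and 6 otherwise; here there are 6. -/

/-- The central extension of `V` by `W` with the bilinear cocycle `B`. -/
@[ext]
structure CentralExtension {V W : Type*} [AddCommGroup V] [Module (ZMod 2) V]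
    [AddCommGroup W] [Module (ZMod 2) W] (B : LinearMap.BilinMap (ZMod 2) V W) where
  /-- The component in the quotient. -/
  fst : V
  /-- The component in the central subgroup. -/
  snd : W

namespace CentralExtension

open scoped commutatorElement

variable {V W : Type*} [AddCommGroup V] [Module (ZMod 2) V]
    [AddCommGroup W] [Module (ZMod 2) W] {B : LinearMap.BilinMap (ZMod 2) V W}

instance : Mul (CentralExtension B) :=
  ⟨fun g h => ⟨g.fst + h.fst, g.snd + h.snd + B g.fst h.fst⟩⟩

instance : One (CentralExtension B) := ⟨⟨0, 0⟩⟩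

instance : Inv (CentralExtension B) :=
  ⟨fun g => ⟨-g.fst, -g.snd + B g.fst g.fst⟩⟩

@[simp] theorem fst_mul (g h : CentralExtension B) : (g * h).fst = g.fst + h.fst := rfl
@[simp] theorem snd_mul (g h : CentralExtension B) :
    (g * h).snd = g.snd + h.snd + B g.fst h.fst := rfl
@[simp] theorem fst_one : (1 : CentralExtension B).fst = 0 := rfl
@[simp] theorem snd_one : (1 : CentralExtension B).snd = 0 := rfl
@[simp] theorem fst_inv (g : CentralExtension B) : g⁻¹.fst = -g.fst := rfl
@[simp] theorem snd_inv (g : CentralExtension B) : g⁻¹.snd = -g.snd + B g.fst g.fst := rfl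

instance : Group (CentralExtension B) :=
  Group.ofLeftAxioms
    (fun g h k => by ext <;> simp <;> abel)
    (fun g => by ext <;> simp)
    (fun g => by ext <;> simp)

/-- The projection onto the quotient. -/
def proj (B : LinearMap.BilinMap (ZMod 2) V W) : CentralExtension B →* Multiplicative V where
  toFun g := Multiplicative.ofAdd g.fst
  map_one' := rfl
  map_mul' _ _ := rfl

/-- The inclusion of the central subgroup. -/
def incl (B : LinearMap.BilinMap (ZMod 2) V W) : Multiplicative W →* CentralExtension B where
  toFun w := ⟨0, w.toAdd⟩
  map_one' := rfl
  map_mul' w w' := by ext <;> simp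

theorem add_self_eq_zero {U : Type*} [AddCommGroup U] [Module (ZMod 2) U] (u : U) : u + u = 0 := by
  rw [← two_smul (ZMod 2) u, show (2 : ZMod 2) = 0 from rfl, zero_smul]

theorem sub_eq_add {U : Type*} [AddCommGroup U] [Module (ZMod 2) U] (u v : U) :
    u - v = u + v := by
  rw [sub_eq_iff_eq_add, add_assoc, add_self_eq_zero, add_zero]

theorem pow_two_eq (g : CentralExtension B) : g ^ 2 = ⟨0, B.toQuadraticMap g.fst⟩ := by
  rw [pow_two]
  ext <;> simp [add_self_eq_zero]

theorem polar_eq (v u : V) : QuadraticMap.polar B.toQuadraticMap v u = B v u + B u v := by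
  simp [QuadraticMap.polar]
  abel

/-- The two products differ by B(v, u) - B(u, v), which is the polar value because signs are
invisible over 𝔽₂. -/
theorem mul_comm_iff (g h : CentralExtension B) :
    g * h = h * g ↔ QuadraticMap.polar B.toQuadraticMap g.fst h.fst = 0 := by
  rw [polar_eq, ← sub_eq_add, sub_eq_zero, CentralExtension.ext_iff]
  simp [add_comm]

theorem mem_center_iff (hB : IsRegular B.toQuadraticMap) (g : CentralExtension B) :
    g ∈ Subgroup.center (CentralExtension B) ↔ g.fst = 0 := by
  rw [Subgroup.mem_center_iff]
  constructor
  · intro h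
    exact hB _ fun u => (mul_comm_iff g ⟨u, 0⟩).1 (h ⟨u, 0⟩).symm
  · intro h k
    rw [eq_comm, mul_comm_iff, h, polar_eq]
    simp

theorem commutatorElement_eq (g h : CentralExtension B) :
    ⁅g, h⁆ = ⟨0, QuadraticMap.polar B.toQuadraticMap g.fst h.fst⟩ := by
  rw [commutatorElement_def, mul_inv_eq_iff_eq_mul, mul_inv_eq_iff_eq_mul, polar_eq]
  ext
  · simp [add_comm]
  · simp only [snd_mul, map_zero, LinearMap.zero_apply, add_zero, fst_mul, zero_add]
    have := add_self_eq_zero (B h.fst g.fst)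
    calc g.snd + h.snd + B g.fst h.fst = g.snd + h.snd + B g.fst h.fst + 0 := by simp
      _ = _ := by rw [← this]; abel

theorem commutator_eq_center (hB : IsRegular B.toQuadraticMap)
    (hW : AddSubgroup.closure {c | ∃ v u, QuadraticMap.polar B.toQuadraticMap v u = c} = ⊤) :
    commutator (CentralExtension B) = Subgroup.center (CentralExtension B) := by
  apply le_antisymm
  · rw [commutator_def, Subgroup.commutator_le]
    intro g _ h _
    rw [mem_center_iff hB, commutatorElement_eq]
  · intro g hg
    rw [mem_center_iff hB] at hg
    have key : ∀ c : W, incl B (Multiplicative.ofAdd c) ∈ commutator (CentralExtension B) := by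
      intro c
      have hc : c ∈ AddSubgroup.closure {c | ∃ v u, QuadraticMap.polar B.toQuadraticMap v u = c} :=
        hW ▸ AddSubgroup.mem_top c
      induction hc using AddSubgroup.closure_induction with
      | mem c hc =>
        obtain ⟨v, u, rfl⟩ := hc
        have := Subgroup.commutator_mem_commutator (Subgroup.mem_top (⟨v, 0⟩ : CentralExtension B))
          (Subgroup.mem_top (⟨u, 0⟩ : CentralExtension B))
        rwa [commutatorElement_eq, ← commutator_def] at this
      | zero => exact one_mem _
      | add c d _ _ hc hd => rw [ofAdd_add, map_mul]; exact mul_mem hc hd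
      | neg c _ hc => rw [ofAdd_neg, map_inv]; exact inv_mem hc
    have := key g.snd
    rwa [show incl B (Multiplicative.ofAdd g.snd) = g by ext <;> simp [incl, hg]] at this

/-- A maximal subgroup contains the centre as soon as the centre is the commutator subgroup. -/
theorem center_le_of_isCoatom {G : Type*} [Group G] (h : commutator G = Subgroup.center G)
    {M : Subgroup G} (hM : IsCoatom M) : Subgroup.center G ≤ M := by
  by_contra hZ
  -- If M misses part of the centre, then G = M · Z(G). Central factors cancel in commutators, so G'
  -- lies in M; but G' is the centre.
  have htop : M ⊔ Subgroup.center G = ⊤ := hM.2 _ (left_lt_sup.2 hZ)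
  apply hZ
  rw [← h, commutator_def, Subgroup.commutator_le]
  intro g _ k _
  obtain ⟨m, hm, z, hz, rfl⟩ := Subgroup.mem_sup_of_normal_right.1 (htop ▸ Subgroup.mem_top g)
  obtain ⟨n, hn, y, hy, rfl⟩ := Subgroup.mem_sup_of_normal_right.1 (htop ▸ Subgroup.mem_top k)
  rw [Subgroup.mem_center_iff] at hz hy
  have : ⁅m * z, n * y⁆ = m * n * m⁻¹ * n⁻¹ := by
    rw [commutatorElement_def, mul_inv_eq_iff_eq_mul, mul_inv_eq_iff_eq_mul]
    calc m * z * (n * y) = m * n * (z * y) := by rw [mul_assoc, ← mul_assoc z, ← hz n]; group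
      _ = m * n * m⁻¹ * (m * (z * y)) := by group
      _ = m * n * m⁻¹ * (n⁻¹ * (n * (m * (y * z)))) := by rw [hz y]; group
      _ = m * n * m⁻¹ * n⁻¹ * (n * y) * (m * z) := by
        rw [show m * (y * z) = y * (m * z) by rw [← mul_assoc, hy m, mul_assoc]]; group
  rw [this]
  exact mul_mem (mul_mem (mul_mem hm hn) (inv_mem hm)) (inv_mem hn)

theorem isCoatom_ker_of_surjective {G : Type*} [Group G] {f : G →* Multiplicative (ZMod 2)}
    (hf : Function.Surjective f) : IsCoatom f.ker := by
  rw [← MonoidHom.comap_bot]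
  refine Subgroup.isCoatom_comap_of_surjective hf ?_
  have : Fact (Nat.card (Multiplicative (ZMod 2))).Prime := ⟨by simpa using Nat.prime_two⟩
  have : IsSimpleGroup (Multiplicative (ZMod 2)) := isSimpleGroup_of_prime_card rfl
  constructor
  · exact bot_ne_top
  · intro K hK
    exact (Subgroup.Normal.eq_bot_or_eq_top (inferInstance : K.Normal)).resolve_left hK.ne'

/-- A nonzero linear functional on V pulls back to a homomorphism onto 𝔽₂, whose kernel is a maximal
subgroup, and these hyperplanes of V meet in 0. Conversely, every maximal subgroup contains the
centre. -/
theorem frattini_eq_center (hB : IsRegular B.toQuadraticMap)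
    (hW : AddSubgroup.closure {c | ∃ v u, QuadraticMap.polar B.toQuadraticMap v u = c} = ⊤) :
    frattini (CentralExtension B) = Subgroup.center (CentralExtension B) := by
  apply le_antisymm
  · intro g hg
    rw [mem_center_iff hB, ← Module.forall_dual_apply_eq_zero_iff (ZMod 2)]
    intro φ
    by_contra hφ
    let f : CentralExtension B →* Multiplicative (ZMod 2) :=
      (AddMonoidHom.toMultiplicative φ.toAddMonoidHom).comp (proj B)
    have hf : Function.Surjective f := by
      intro c
      refine ⟨⟨(c.toAdd / φ g.fst) • g.fst, 0⟩, ?_⟩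
      change Multiplicative.ofAdd (φ ((c.toAdd / φ g.fst) • g.fst)) = c
      rw [map_smul, smul_eq_mul, div_mul_cancel₀ _ hφ, ofAdd_toAdd]
    have : f g = 1 := frattini_le_coatom (isCoatom_ker_of_surjective hf) hg
    exact hφ (congrArg Multiplicative.toAdd this)
  · simp only [frattini, Order.radical, le_iInf_iff]
    intro M hM
    exact center_le_of_isCoatom (commutator_eq_center hB hW) hM

theorem isSpecialTwoGroup [Finite V] [Finite W] [Nontrivial V] (hB : IsRegular B.toQuadraticMap)
    (hW : AddSubgroup.closure {c | ∃ v u, QuadraticMap.polar B.toQuadraticMap v u = c} = ⊤) :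
    IsSpecialTwoGroup (CentralExtension B) where
  finite := Finite.of_injective (fun g : CentralExtension B => (g.fst, g.snd)) fun g h hgh =>
    CentralExtension.ext (congrArg Prod.fst hgh) (congrArg Prod.snd hgh)
  isTwoGroup g := by
    refine ⟨2, ?_⟩
    rw [show 2 ^ 2 = 2 * 2 from rfl, pow_mul, pow_two_eq, pow_two_eq]
    ext <;> simp
  noncomm := by
    obtain ⟨v, hv⟩ := exists_ne (0 : V)
    have : ¬ ∀ u, QuadraticMap.polar B.toQuadraticMap v u = 0 := fun h => hv (hB v h)
    push Not at this
    obtain ⟨u, hu⟩ := this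
    exact ⟨⟨v, 0⟩, ⟨u, 0⟩, fun h => hu ((mul_comm_iff _ _).1 h)⟩
  commutator_eq_frattini := (commutator_eq_center hB hW).trans (frattini_eq_center hB hW).symm
  frattini_eq_center := frattini_eq_center hB hW
  center_eq_omega := by
    apply le_antisymm
    · intro g hg
      refine Subgroup.subset_closure ⟨hg, ?_⟩
      rw [mem_center_iff hB] at hg
      rw [pow_two_eq, hg, map_zero]
      rfl
    · rw [omegaCenter, Subgroup.closure_le]
      exact fun g hg => hg.1

theorem ker_proj (hB : IsRegular B.toQuadraticMap) :
    (proj B).ker = Subgroup.center (CentralExtension B) := by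
  ext g
  rw [mem_center_iff hB]
  exact Iff.rfl

/-- The centre of the extension is the subgroup `W`. -/
def centerEquiv (hB : IsRegular B.toQuadraticMap) :
    Multiplicative W ≃* Subgroup.center (CentralExtension B) where
  toFun w := ⟨incl B w, (mem_center_iff hB _).2 rfl⟩
  invFun g := Multiplicative.ofAdd g.1.snd
  left_inv _ := rfl
  right_inv g := by
    ext
    · exact ((mem_center_iff hB _).1 g.2).symm
    · rfl
  map_mul' w w' := Subtype.ext (map_mul (incl B) w w')

theorem isSpecialTwoGroupOf [Finite V] [Finite W] [Nontrivial V]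
    (hB : IsRegular B.toQuadraticMap)
    (hW : AddSubgroup.closure {c | ∃ v u, QuadraticMap.polar B.toQuadraticMap v u = c} = ⊤) :
    IsSpecialTwoGroupOf (CentralExtension B) B.toQuadraticMap := by
  refine ⟨isSpecialTwoGroup hB hW,
    (QuotientGroup.quotientMulEquivOfEq (ker_proj hB).symm).trans
      (QuotientGroup.quotientKerEquivOfSurjective (proj B) fun v => ⟨⟨v.toAdd, 0⟩, rfl⟩),
    centerEquiv hB, fun x => ?_⟩
  rw [pow_two_eq]
  rfl

end CentralExtension

/-- On a vector space every quadratic map is the diagonal of a bilinear map. In characteristic 2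
this B cannot be symmetric unless the polar map vanishes. -/
theorem exists_isSpecialTwoGroupOf {V W : Type u} [AddCommGroup V] [Module (ZMod 2) V]
    [AddCommGroup W] [Module (ZMod 2) W] [Finite V] [Finite W] [Nontrivial V]
    {q : QuadraticMap (ZMod 2) V W} (hq : IsRegular q)
    (hW : AddSubgroup.closure {c | ∃ v u, QuadraticMap.polar q v u = c} = ⊤) :
    ∃ (G : Type u) (_ : Group G), IsSpecialTwoGroupOf G q := by
  obtain ⟨B, rfl⟩ := LinearMap.BilinMap.toQuadraticMap_surjective q
  exact ⟨CentralExtension B, inferInstance, CentralExtension.isSpecialTwoGroupOf hq hW⟩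

end SpecialTwoGroups

namespace SpecialTwoGroups

/-! ### The Arf invariant over 𝔽₂ through the number of zeros. -/

section Arf

theorem isRegular_iff_ker_eq_bot {F V : Type*} [CommRing F] [AddCommGroup V] [Module F V]
    (Q : QuadraticForm F V) :
    IsRegular Q ↔ LinearMap.ker (QuadraticMap.polarBilin Q) = ⊥ := by
  rw [LinearMap.ker_eq_bot']
  simp only [IsRegular, LinearMap.ext_iff, QuadraticMap.polarBilin_apply_apply,
    LinearMap.zero_apply]

/-- A regular form is isometric to the form it induces on the quotient by its radical. -/
theorem equivalent_inducedForm {F V : Type*} [CommRing F] [AddCommGroup V] [Module F V]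
    {Q : QuadraticForm F V} (hQ : IsRegular Q)
    (h : LinearMap.ker (QuadraticMap.polarBilin Q) ≤ Q.radical) :
    QuadraticMap.Equivalent Q (inducedForm Q h) := by
  rw [isRegular_iff_ker_eq_bot] at hQ
  exact ⟨(Submodule.quotEquivOfEqBot _ hQ).symm, fun v => QuadraticMap.lift_mk h v⟩

theorem artinSchreierSubgroup_zmod_two : artinSchreierSubgroup (ZMod 2) = ⊥ := by
  rw [eq_bot_iff]
  rintro _ ⟨x, rfl⟩
  have : ∀ x : ZMod 2, x ^ 2 + x = 0 := by decide
  exact this x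

variable {V : Type*} [AddCommGroup V] [Module (ZMod 2) V]

theorem eval_of_isSymplecticBasis {Q : QuadraticForm (ZMod 2) V}
    {b : Module.Basis (Fin 2 ⊕ Fin 2) (ZMod 2) V} (hb : IsSymplecticBasis Q b)
    (c : Fin 2 ⊕ Fin 2 → ZMod 2) :
    Q (b.equivFun.symm c) =
      c (.inl 0) * c (.inl 0) * Q (b (.inl 0)) + c (.inl 1) * c (.inl 1) * Q (b (.inl 1))
      + c (.inr 0) * c (.inr 0) * Q (b (.inr 0)) + c (.inr 1) * c (.inr 1) * Q (b (.inr 1))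
      + c (.inl 0) * c (.inr 0) + c (.inl 1) * c (.inr 1) := by
  have h00 := hb 0 0
  have h01 := hb 0 1
  have h10 := hb 1 0
  have h11 := hb 1 1
  simp only [Module.Basis.equivFun_symm_apply, Fintype.sum_sum_type, Fin.sum_univ_two,
    QuadraticMap.map_add Q, QuadraticMap.map_smul, QuadraticMap.polar_add_left,
    QuadraticMap.polar_add_right, QuadraticMap.polar_smul_left, QuadraticMap.polar_smul_right]
  rw [h00.2.2, h01.1, h01.2.1, h01.2.2, h10.2.2, h11.2.2]
  simp
  ring

/-- A four-dimensional form over `𝔽₂` with exactly six zeros has Arf invariant one. -/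
theorem arfInvariant_ne_zero (Q : QuadraticForm (ZMod 2) V)
    {b : Module.Basis (Fin 2 ⊕ Fin 2) (ZMod 2) V} (hb : IsSymplecticBasis Q b)
    (hcard : Nat.card {v // Q v = 0} = 6) : arfInvariant Q ≠ 0 := by
  -- `arfInvariant` evaluates on an unspecified symplectic basis, so the sum must be shown nonzero
  -- for all of them. The number of zeros does not depend on the basis.
  have key : ∀ b' : Module.Basis (Fin 2 ⊕ Fin 2) (ZMod 2) V, IsSymplecticBasis Q b' →
      ∑ i, Q (b' (Sum.inl i)) * Q (b' (Sum.inr i)) ≠ 0 := by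
    intro b' hb' h0
    let e : {c : Fin 2 ⊕ Fin 2 → ZMod 2 // Q (b'.equivFun.symm c) = 0} ≃ {v // Q v = 0} :=
      b'.equivFun.symm.toEquiv.subtypeEquiv fun c => Iff.rfl
    let e' : (ZMod 2 × ZMod 2) × (ZMod 2 × ZMod 2) ≃ (Fin 2 ⊕ Fin 2 → ZMod 2) :=
      ((finTwoArrowEquiv _).symm.prodCongr (finTwoArrowEquiv _).symm).trans
        (Equiv.sumArrowEquivProdArrow _ _ _).symm
    have hc : Nat.card {p : (ZMod 2 × ZMod 2) × (ZMod 2 × ZMod 2) //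
        Q (b'.equivFun.symm (e' p)) = 0} = 6 := by
      rw [← hcard]
      exact Nat.card_congr ((e'.subtypeEquiv fun p => Iff.rfl).trans e)
    simp only [eval_of_isSymplecticBasis hb'] at hc
    rw [Fin.sum_univ_two] at h0
    revert hc h0
    generalize Q (b' (.inl 0)) = α
    generalize Q (b' (.inl 1)) = β
    generalize Q (b' (.inr 0)) = γ
    generalize Q (b' (.inr 1)) = δ
    intro h0 hc
    change Nat.card {p : (ZMod 2 × ZMod 2) × (ZMod 2 × ZMod 2) //
      p.1.1 * p.1.1 * α + p.1.2 * p.1.2 * β + p.2.1 * p.2.1 * γ + p.2.2 * p.2.2 * δ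
        + p.1.1 * p.2.1 + p.1.2 * p.2.2 = 0} = 6 at hc
    rw [Nat.card_eq_fintype_card] at hc
    -- Only the four values on the basis remain: αγ + βδ = 0 is incompatible with six zeros in each
    -- of the 16 cases.
    revert α β γ δ
    decide
  have hex : ∃ (n : ℕ) (b : Module.Basis (Fin n ⊕ Fin n) (ZMod 2) V), IsSymplecticBasis Q b :=
    ⟨2, b, hb⟩
  rw [arfInvariant, dif_pos hex, Ne, QuotientAddGroup.eq_zero_iff, artinSchreierSubgroup_zmod_two,
    AddSubgroup.mem_bot]
  have hb'' := hex.choose_spec.choose_spec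
  generalize hex.choose_spec.choose = b' at hb''
  -- The chosen basis comes with its own length; the dimension forces it to be 2.
  have hn : hex.choose = 2 := by
    have h1 := Module.finrank_eq_card_basis b'
    have h2 := Module.finrank_eq_card_basis b
    simp only [Fintype.card_sum, Fintype.card_fin] at h1 h2
    omega
  clear hcard
  generalize hex.choose = n at b' hb'' hn
  subst hn
  exact key b' hb''

end Arf

/-! ### Finite verifications for q and its transfer. -/

section Transfer

theorem transfer_apply (w x y z : ZMod 2) :
    transfer sMap qMap ![w, x, y, z] = z ^ 2 + w * x + w * z + x * y + w * y := rfl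

theorem isRegular_qMap : IsRegular qMap := by
  unfold IsRegular QuadraticMap.polar
  decide

theorem isRegular_transfer : IsRegular (transfer sMap qMap) := by
  unfold IsRegular QuadraticMap.polar
  decide

theorem closure_polar_qMap :
    AddSubgroup.closure {c | ∃ v u, QuadraticMap.polar qMap v u = c} = ⊤ := by
  have : ∀ c : Fin 2 → ZMod 2, ∃ v u, QuadraticMap.polar qMap v u = c := by
    unfold QuadraticMap.polar
    decide
  exact eq_top_iff.2 fun c _ => AddSubgroup.subset_closure (this c)

set_option maxRecDepth 4000 in
theorem table_spec : (∀ v : Fin 4 → ZMod 2, v ≠ 0 → ∃ a, (v, a) ∈ table) ∧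
    ∀ v a, (v, a) ∈ table → v ≠ a ∧ qMap a = 0 ∧ qMap (a - v) = 0 := by
  constructor
  · decide
  · have : ∀ p ∈ table, p.1 ≠ p.2 ∧ qMap p.2 = 0 ∧ qMap (p.2 - p.1) = 0 := by decide
    exact fun v a h => this (v, a) h

/-- The substitution that turns the transfer into `[1, 1] ⊥ [0, 0]`. -/
def substitution :
    ((ZMod 2 × ZMod 2) × (ZMod 2 × ZMod 2)) →ₗ[ZMod 2] (Fin 4 → ZMod 2) where
  toFun p := ![p.1.1 + p.1.2 + p.2.2, p.1.2 + p.2.1, p.2.1 + p.1.1, p.2.1 + p.2.2]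
  map_add' := by decide
  map_smul' := by decide

theorem substitution_bijective : Function.Bijective substitution :=
  (Fintype.bijective_iff_injective_and_card _).2 ⟨by decide, by simp [ZMod.card]⟩

theorem transfer_substitution (w x y z : ZMod 2) :
    transfer sMap qMap ![w + x + z, x + y, y + w, y + z] =
      ((binaryForm (1 : ZMod 2) 1).prod (binaryForm (0 : ZMod 2) 0)) ((w, x), (y, z)) := by
  rw [transfer_apply, QuadraticMap.prod_apply, binaryForm_apply, binaryForm_apply]
  revert w x y z
  decide

/-- The isometry given by the substitution. -/
noncomputable def substitutionIsometry :
    ((binaryForm (1 : ZMod 2) 1).prod (binaryForm (0 : ZMod 2) 0)).IsometryEquiv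
      (transfer sMap qMap) where
  toLinearEquiv := LinearEquiv.ofBijective substitution substitution_bijective
  map_app' p := transfer_substitution p.1.1 p.1.2 p.2.1 p.2.2

theorem card_zeros_transfer : Nat.card {v // transfer sMap qMap v = 0} = 6 := by
  rw [Nat.card_eq_fintype_card]
  decide

end Transfer

end SpecialTwoGroups

/-! ### Real and complex modules over the relations of ℍ ⊗ M₂. -/

namespace SpecialTwoGroups

/-- `I, J` generate a quaternion algebra, `Y, Z` a split one, and the two commute. -/
structure IsQuaternionSplit {A : Type*} [Ring A] (I J Y Z : A) : Prop where
  II : I * I = -1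
  JJ : J * J = -1
  YY : Y * Y = 1
  ZZ : Z * Z = 1
  IJ : I * J = -(J * I)
  YZ : Y * Z = -(Z * Y)
  IY : I * Y = Y * I
  IZ : I * Z = Z * I
  JY : J * Y = Y * J
  JZ : J * Z = Z * J

namespace IsQuaternionSplit

theorem of_injective {A B : Type*} [Ring A] [Ring B] {I J Y Z : A} (φ : A →+* B)
    (hφ : Function.Injective φ) (h : IsQuaternionSplit (φ I) (φ J) (φ Y) (φ Z)) :
    IsQuaternionSplit I J Y Z := by
  constructor <;> apply hφ <;> simp only [map_mul, map_neg, map_one]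
  exacts [h.II, h.JJ, h.YY, h.ZZ, h.IJ, h.YZ, h.IY, h.IZ, h.JY, h.JZ]

theorem map {A B : Type*} [Ring A] [Ring B] {I J Y Z : A} (φ : A →+* B)
    (h : IsQuaternionSplit I J Y Z) : IsQuaternionSplit (φ I) (φ J) (φ Y) (φ Z) := by
  constructor <;> simp only [← map_mul, ← map_neg, ← map_one φ]
  exacts [congrArg φ h.II, congrArg φ h.JJ, congrArg φ h.YY, congrArg φ h.ZZ, congrArg φ h.IJ,
    congrArg φ h.YZ, congrArg φ h.IY, congrArg φ h.IZ, congrArg φ h.JY, congrArg φ h.JZ]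

section Module

variable {F E : Type*} [Field F] [AddCommGroup E] [Module F E] {I J Y Z : Module.End F E}

theorem II_apply (h : IsQuaternionSplit I J Y Z) (v : E) : I (I v) = -v :=
  LinearMap.congr_fun h.II v
theorem JJ_apply (h : IsQuaternionSplit I J Y Z) (v : E) : J (J v) = -v :=
  LinearMap.congr_fun h.JJ v
theorem YY_apply (h : IsQuaternionSplit I J Y Z) (v : E) : Y (Y v) = v :=
  LinearMap.congr_fun h.YY v
theorem ZZ_apply (h : IsQuaternionSplit I J Y Z) (v : E) : Z (Z v) = v :=
  LinearMap.congr_fun h.ZZ v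
theorem JI_apply (h : IsQuaternionSplit I J Y Z) (v : E) : J (I v) = -I (J v) :=
  eq_neg_iff_add_eq_zero.2 (eq_neg_iff_add_eq_zero.1 (LinearMap.congr_fun h.IJ v) ▸ add_comm _ _)
theorem YZ_apply (h : IsQuaternionSplit I J Y Z) (v : E) : Y (Z v) = -Z (Y v) :=
  LinearMap.congr_fun h.YZ v
theorem YI_apply (h : IsQuaternionSplit I J Y Z) (v : E) : Y (I v) = I (Y v) :=
  (LinearMap.congr_fun h.IY v).symm
theorem IZ_apply (h : IsQuaternionSplit I J Y Z) (v : E) : I (Z v) = Z (I v) :=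
  LinearMap.congr_fun h.IZ v
theorem YJ_apply (h : IsQuaternionSplit I J Y Z) (v : E) : Y (J v) = J (Y v) :=
  (LinearMap.congr_fun h.JY v).symm
theorem JZ_apply (h : IsQuaternionSplit I J Y Z) (v : E) : J (Z v) = Z (J v) :=
  LinearMap.congr_fun h.JZ v

/-- The vector w + Yw is fixed by Y. If it vanishes, w lies in the (-1)-eigenspace, which Z carries
to the (+1)-eigenspace. -/
theorem exists_fixed [CharZero F] [Nontrivial E] (h : IsQuaternionSplit I J Y Z) :
    ∃ v : E, v ≠ 0 ∧ Y v = v := by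
  obtain ⟨w, hw⟩ := exists_ne (0 : E)
  by_cases hY : w + Y w = 0
  · refine ⟨Z w, fun h0 => hw ?_, ?_⟩
    · rw [← h.ZZ_apply w, h0, map_zero]
    · rw [h.YZ_apply, ← map_neg, ← eq_neg_of_add_eq_zero_left hY]
  · exact ⟨w + Y w, hY, by rw [map_add, h.YY_apply, add_comm]⟩

end Module

section Real

variable {E : Type*} [AddCommGroup E] [Module ℝ E] {I J Y Z : Module.End ℝ E}

/-- Applying the conjugate quaternion a - bI - cJ - dIJ to the relation leaves the norm a² + b² + c²
+ d² times v. A sum of real squares vanishes only termwise; this is where the ground field ℝ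
matters. -/
theorem coeff_eq_zero (h : IsQuaternionSplit I J Y Z) {v : E} (hv : v ≠ 0) {a b c d : ℝ}
    (h0 : a • v + b • I v + c • J v + d • I (J v) = 0) : a = 0 ∧ b = 0 ∧ c = 0 ∧ d = 0 := by
  have hI := congrArg I h0
  have hJ := congrArg J h0
  have hIJ := congrArg I hJ
  simp only [map_add, map_smul, map_neg, map_zero, h.II_apply, h.JJ_apply, h.JI_apply,
    neg_neg] at hI hJ hIJ
  have key : (a ^ 2 + b ^ 2 + c ^ 2 + d ^ 2) • v = 0 := by
    linear_combination (norm := module) a • h0 - b • hI - c • hJ - d • hIJ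
  have hs := (smul_eq_zero.1 key).resolve_right hv
  have ha : a ^ 2 = 0 := by nlinarith [sq_nonneg a, sq_nonneg b, sq_nonneg c, sq_nonneg d]
  have hb : b ^ 2 = 0 := by nlinarith [sq_nonneg a, sq_nonneg b, sq_nonneg c, sq_nonneg d]
  have hc : c ^ 2 = 0 := by nlinarith [sq_nonneg a, sq_nonneg b, sq_nonneg c, sq_nonneg d]
  have hd : d ^ 2 = 0 := by nlinarith [sq_nonneg a, sq_nonneg b, sq_nonneg c, sq_nonneg d]
  exact ⟨pow_eq_zero_iff two_ne_zero |>.1 ha, pow_eq_zero_iff two_ne_zero |>.1 hb,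
    pow_eq_zero_iff two_ne_zero |>.1 hc, pow_eq_zero_iff two_ne_zero |>.1 hd⟩

/-- A nonzero real representation of the algebra has dimension at least eight. -/
theorem eight_le_finrank [Nontrivial E] [FiniteDimensional ℝ E] (h : IsQuaternionSplit I J Y Z) :
    8 ≤ Module.finrank ℝ E := by
  obtain ⟨v, hv, hY⟩ := h.exists_fixed
  have hli : LinearIndependent ℝ
      ![v, I v, J v, I (J v), Z v, Z (I v), Z (J v), Z (I (J v))] := by
    rw [Fintype.linearIndependent_iff]
    intro g hg
    simp only [Fin.sum_univ_eight] at hg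
    change g 0 • v + g 1 • I v + g 2 • J v + g 3 • I (J v) + g 4 • Z v + g 5 • Z (I v)
      + g 6 • Z (J v) + g 7 • Z (I (J v)) = 0 at hg
    -- Y fixes the first four vectors and negates the last four, so half the sum and half the
    -- difference of the two relations separate them.
    have hg' := congrArg Y hg
    simp only [map_add, map_smul, map_zero, h.YZ_apply, h.YI_apply, h.YJ_apply, hY] at hg'
    have h1 : g 0 • v + g 1 • I v + g 2 • J v + g 3 • I (J v) = 0 := by
      linear_combination (norm := module) (1 / 2 : ℝ) • hg + (1 / 2 : ℝ) • hg'
    have h2 : g 4 • Z v + g 5 • Z (I v) + g 6 • Z (J v) + g 7 • Z (I (J v)) = 0 := by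
      linear_combination (norm := module) (1 / 2 : ℝ) • hg - (1 / 2 : ℝ) • hg'
    have h3 := congrArg Z h2
    simp only [map_add, map_smul, map_zero, h.ZZ_apply] at h3
    obtain ⟨h0, h1, h2, h3'⟩ := h.coeff_eq_zero hv h1
    obtain ⟨h4, h5, h6, h7⟩ := h.coeff_eq_zero hv h3
    intro i
    fin_cases i <;> assumption
  simpa using hli.fintype_card_le_finrank

end Real

section Complex

variable {E : Type*} [AddCommGroup E] [Module ℂ E] {I J Y Z : Module.End ℂ E}

/-- On a Y-fixed v, the vector v - i·Iv lies in the i-eigenspace of I. If it vanishes, then Iv =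
-iv, and Jv has eigenvalue i because J anticommutes with I. Y commutes with I and J, so both
candidates stay fixed by Y. -/
theorem exists_common_eigenvector [Nontrivial E] (h : IsQuaternionSplit I J Y Z) :
    ∃ v : E, v ≠ 0 ∧ Y v = v ∧ I v = Complex.I • v := by
  obtain ⟨v, hv, hY⟩ := h.exists_fixed
  by_cases h0 : v - Complex.I • I v = 0
  · refine ⟨J v, fun hJ => hv ?_, ?_, ?_⟩
    · rw [← neg_eq_zero, ← h.JJ_apply v, hJ, map_zero]
    · rw [h.YJ_apply, hY]
    · have h1 := congrArg (fun u => Complex.I • J u) h0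
      simp only [map_sub, map_smul, h.JI_apply, smul_sub, smul_neg, smul_smul, Complex.I_mul_I,
        map_zero, smul_zero] at h1
      linear_combination (norm := module) -h1
  · refine ⟨_, h0, ?_, ?_⟩
    · rw [map_sub, map_smul, h.YI_apply, hY]
    · rw [map_sub, map_smul, h.II_apply, smul_sub, smul_smul, Complex.I_mul_I]
      module

/-- A nonzero complex representation of the algebra contains a nonzero invariant subspace of
dimension at most four. -/
theorem exists_invariant_submodule [Nontrivial E] (h : IsQuaternionSplit I J Y Z) :
    ∃ S : Submodule ℂ E, S ≠ ⊥ ∧ Module.finrank ℂ S ≤ 4 ∧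
      (∀ v ∈ S, I v ∈ S) ∧ (∀ v ∈ S, J v ∈ S) ∧ (∀ v ∈ S, Y v ∈ S) ∧ (∀ v ∈ S, Z v ∈ S) := by
  obtain ⟨v, hv, hY, hI⟩ := h.exists_common_eigenvector
  -- I and Y act on each of these vectors by a scalar, while J and Z permute them up to sign.
  let b : Fin 4 → E := ![v, J v, Z v, Z (J v)]
  have h0 : v ∈ Submodule.span ℂ (Set.range b) := Submodule.subset_span ⟨0, rfl⟩
  have h1 : J v ∈ Submodule.span ℂ (Set.range b) := Submodule.subset_span ⟨1, rfl⟩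
  have h2 : Z v ∈ Submodule.span ℂ (Set.range b) := Submodule.subset_span ⟨2, rfl⟩
  have h3 : Z (J v) ∈ Submodule.span ℂ (Set.range b) := Submodule.subset_span ⟨3, rfl⟩
  have hIJ : I (J v) = -(Complex.I • J v) := by
    rw [← neg_eq_iff_eq_neg, ← h.JI_apply, hI, map_smul]
  have inv : ∀ T : Module.End ℂ E, T v ∈ Submodule.span ℂ (Set.range b) →
      T (J v) ∈ Submodule.span ℂ (Set.range b) → T (Z v) ∈ Submodule.span ℂ (Set.range b) →
      T (Z (J v)) ∈ Submodule.span ℂ (Set.range b) →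
      ∀ u ∈ Submodule.span ℂ (Set.range b), T u ∈ Submodule.span ℂ (Set.range b) := by
    intro T t0 t1 t2 t3
    change Submodule.span ℂ (Set.range b) ≤ (Submodule.span ℂ (Set.range b)).comap T
    rw [Submodule.span_le]
    rintro _ ⟨i, rfl⟩
    fin_cases i <;> assumption
  refine ⟨Submodule.span ℂ (Set.range b), fun hb => hv ?_, ?_, inv I ?_ ?_ ?_ ?_, inv J ?_ ?_ ?_ ?_,
    inv Y ?_ ?_ ?_ ?_, inv Z ?_ ?_ ?_ ?_⟩
  · rwa [hb, Submodule.mem_bot] at h0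
  · exact (finrank_range_le_card b).trans_eq (Fintype.card_fin 4)
  all_goals try simp only [h.JJ_apply, h.ZZ_apply, h.YZ_apply, h.IZ_apply, h.YJ_apply, h.JZ_apply,
    hY, hI, hIJ, map_neg, map_smul]
  all_goals first
    | assumption
    | exact Submodule.neg_mem _ ‹_›
    | exact Submodule.smul_mem _ _ ‹_›
    | exact Submodule.neg_mem _ (Submodule.smul_mem _ _ ‹_›)

end Complex

end IsQuaternionSplit

/-! ### Irreducible representations with a prescribed central character. -/

section CentralCharacter

variable {G : Type*} [Group G]

/-- The right regular representation on complex functions. -/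
def rightRegular (G : Type*) [Group G] : Representation ℂ G (G → ℂ) where
  toFun h := LinearMap.funLeft ℂ ℂ (fun g => g * h)
  map_one' := by ext; simp [LinearMap.funLeft]
  map_mul' h k := by ext; simp [LinearMap.funLeft, mul_assoc]

theorem rightRegular_apply (h g : G) (f : G → ℂ) : rightRegular G h f g = f (g * h) := rfl

/-- The functions on which the centre acts through `χ`. -/
def isotypic (χ : Subgroup.center G →* ℤˣ) : Subrepresentation (rightRegular G) where
  toSubmodule :=
    { carrier := {f | ∀ (z : Subgroup.center G) (g : G), f (g * z) = ((χ z : ℤ) : ℂ) * f g}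
      zero_mem' := by simp
      add_mem' := fun {f f'} hf hf' z g => by simp [hf z g, hf' z g, mul_add]
      smul_mem' := fun c f hf z g => by simp [hf z g, mul_left_comm] }
  apply_mem_toSubmodule h f hf z g := by
    rw [rightRegular_apply, rightRegular_apply, mul_assoc,
      ← (Subgroup.mem_center_iff.1 z.2 h), ← mul_assoc]
    exact hf z (g * h)

/-- The extension of χ by zero outside the centre is a nonzero member. -/
theorem isotypic_ne_bot (χ : Subgroup.center G →* ℤˣ) : isotypic χ ≠ ⊥ := by
  classical
  intro hbot
  let f : G → ℂ := fun g => if hg : g ∈ Subgroup.center G then ((χ ⟨g, hg⟩ : ℤ) : ℂ) else 0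
  have hf : f ∈ isotypic χ := by
    intro z g
    by_cases hg : g ∈ Subgroup.center G
    · have hgz : g * z ∈ Subgroup.center G := mul_mem hg z.2
      simp only [f, dif_pos hg, dif_pos hgz]
      rw [show (⟨g * z, hgz⟩ : Subgroup.center G) = z * ⟨g, hg⟩ from
        Subtype.ext (Subgroup.mem_center_iff.1 z.2 g), map_mul]
      push_cast
      rfl
    · have hgz : g * z ∉ Subgroup.center G := fun h => hg ((Subgroup.mul_mem_cancel_right _ z.2).1 h)
      simp [f, dif_neg hg, dif_neg hgz]
  rw [hbot] at hf
  have h1 : f 1 = 0 := congrFun (show f = 0 from hf) 1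
  simp [f, one_mem] at h1

/-- Every sign character of the centre is the central character of an irreducible
representation. -/
theorem exists_irreducible_of_centralCharacter [Finite G] (χ : Subgroup.center G →* ℤˣ) :
    ∃ (n : ℕ) (ρ : Representation ℂ G (Fin n → ℂ)), ρ.IsIrreducible ∧
      ∀ z : Subgroup.center G, ρ z = (((χ z : ℤˣ) : ℤ) : Module.End ℂ (Fin n → ℂ)) := by
  -- G is finite, so the function space is finite-dimensional and descending chains of
  -- subrepresentations stop: below `isotypic χ` there is a minimal nonzero one.
  have hwf : WellFounded ((· < ·) : Subrepresentation (rightRegular G) → _ → Prop) :=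
    Subrelation.wf (fun {a b} (hab : a < b) => show a.toSubmodule < b.toSubmodule from hab)
      (InvImage.wf Subrepresentation.toSubmodule wellFounded_lt)
  have := isAtomic_of_orderBot_wellFounded_lt hwf
  obtain ⟨a, ha, hale⟩ := (eq_bot_or_exists_atom_le (isotypic χ)).resolve_left (isotypic_ne_bot χ)
  let e := (Module.finBasis ℂ a.toSubmodule).equivFun
  let ρ : Representation ℂ G (Fin (Module.finrank ℂ a.toSubmodule) → ℂ) :=
    (e.conjRingEquiv : Module.End ℂ _ →* Module.End ℂ _).comp a.toRepresentation
  have hρ : ∀ g u, ρ g u = e (a.toRepresentation g (e.symm u)) := fun g u => rfl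
  refine ⟨_, ρ, ?_, ?_⟩
  -- Irreducibility is read off inside the function space: ι maps subrepresentations of ρ
  -- injectively to those below the atom `a`.
  · let ι := a.toSubmodule.subtype ∘ₗ e.symm.toLinearMap
    have hι : Function.Injective ι := Subtype.val_injective.comp e.symm.injective
    have hι' : ∀ g u, ι (ρ g u) = rightRegular G g (ι u) := by
      intro g u
      change ((e.symm (ρ g u) : a.toSubmodule) : G → ℂ) = _
      rw [hρ, e.symm_apply_apply]
      rfl
    have hrange : LinearMap.range ι = a.toSubmodule := by
      rw [LinearMap.range_comp, LinearEquiv.range, Submodule.map_top, Submodule.range_subtype]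
    let im (p : Subrepresentation ρ) : Subrepresentation (rightRegular G) :=
      { toSubmodule := p.toSubmodule.map ι
        apply_mem_toSubmodule := by
          rintro g _ ⟨u, hu, rfl⟩
          exact ⟨ρ g u, p.apply_mem_toSubmodule g hu, hι' g u⟩ }
    have him : ∀ p, im p = ⊥ ∨ im p = a := by
      intro p
      refine ha.le_iff.1 ?_
      change p.toSubmodule.map ι ≤ a.toSubmodule
      exact LinearMap.map_le_range.trans_eq hrange
    refine { exists_pair_ne := ⟨⊥, ⊤, fun h => ha.1 ?_⟩, eq_bot_or_eq_top := fun p => ?_ }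
    · apply Subrepresentation.toSubmodule_injective
      have h' : (⊥ : Submodule ℂ (Fin (Module.finrank ℂ a.toSubmodule) → ℂ)) = ⊤ :=
        congrArg Subrepresentation.toSubmodule h
      rw [← hrange, LinearMap.range_eq_map, ← h', Submodule.map_bot]
      rfl
    · refine (him p).imp (fun h => ?_) (fun h => ?_) <;>
        apply Subrepresentation.toSubmodule_injective <;>
        apply Submodule.map_injective_of_injective hι <;>
        refine (congrArg Subrepresentation.toSubmodule h).trans ?_
      · exact (Submodule.map_bot ι).symm
      · exact hrange.symm.trans (LinearMap.range_eq_map ι)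
  · intro z
    refine LinearMap.ext fun u => ?_
    rw [hρ, Module.End.intCast_apply, ← e.apply_symm_apply (((χ z : ℤˣ) : ℤ) • u)]
    congr 1
    rw [map_zsmul]
    apply Subtype.ext
    funext g
    have := hale (e.symm u).2 z g
    change ((e.symm u : a.toSubmodule) : G → ℂ) (g * z) = _
    rw [this]
    simp

end CentralCharacter

end SpecialTwoGroups

/-! ### The groups of q: order, strong reality, and a symplectic representation. -/

namespace SpecialTwoGroups

/-- The sign `(-1) ^ c` attached to `c : ZMod 2`. -/
def sign : Multiplicative (ZMod 2) →* ℤˣ where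
  toFun c := if c = 1 then 1 else -1
  map_one' := rfl
  map_mul' := by decide

/-- A homomorphism whose squares are the signs given by `Q` satisfies the sign commutation rule
given by the polar form of `Q`. -/
theorem map_mul_eq_sign_smul {G V A : Type*} [Group G] [AddCommGroup V] [Ring A] {Q : V → ZMod 2}
    (π : G →* Multiplicative V) (f : G →* A)
    (hf : ∀ x, f x * f x = (sign (.ofAdd (Q (π x).toAdd)) : ℤˣ) • (1 : A)) (x y : G) :
    f x * f y =
      sign (.ofAdd (QuadraticMap.polar Q (π x).toAdd (π y).toAdd)) • (f y * f x) := by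
  have hxy := hf (x * y)
  have hp : sign (.ofAdd (QuadraticMap.polar Q (π x).toAdd (π y).toAdd)) =
      sign (.ofAdd (Q (π (x * y)).toAdd)) * sign (.ofAdd (Q (π x).toAdd)) *
        sign (.ofAdd (Q (π y).toAdd)) := by
    rw [← map_mul, ← map_mul, ← ofAdd_add, ← ofAdd_add, map_mul, toAdd_mul, QuadraticMap.polar,
      CharTwo.sub_eq_add, CharTwo.sub_eq_add]
  have hx := hf x
  have hy := hf y
  rw [hp]
  generalize sign (.ofAdd (Q (π (x * y)).toAdd)) = c at *
  generalize sign (.ofAdd (Q (π x).toAdd)) = a at *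
  generalize sign (.ofAdd (Q (π y).toAdd)) = b at *
  -- Both sides are the word xxyxyy. Inserting the scalar squares a, b, c of x, y, xy gives ab·yx =
  -- c·xy, whence xy = abc·yx.
  have h1 : (f x * f x) * (f y * f x) * (f y * f y) = f x * (f (x * y) * f (x * y)) * f y := by
    rw [map_mul]; noncomm_ring
  rw [hx, hy, hxy] at h1
  simp only [smul_mul_assoc, mul_smul_comm, one_mul, mul_one] at h1
  rw [mul_assoc, mul_smul, mul_comm a b, mul_smul, h1, smul_smul, Int.units_mul_self, one_smul]

variable {G : Type u} [Group G]

theorem card_of_isSpecialTwoGroupOf (h : IsSpecialTwoGroupOf G qMap) : Nat.card G = 64 := by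
  obtain ⟨-, eV, eW, -⟩ := h
  rw [Subgroup.card_eq_card_quotient_mul_card_subgroup (Subgroup.center G),
    Nat.card_congr eV.toEquiv, ← Nat.card_congr eW.toEquiv]
  simp [Nat.card_eq_fintype_card, ZMod.card]

theorem isStronglyReal_of_isSpecialTwoGroupOf (h : IsSpecialTwoGroupOf G qMap) :
    IsStronglyReal G := by
  obtain ⟨-, eV, eW, hq⟩ := h
  have hsq : ∀ x : G, qMap (eV (x : G ⧸ Subgroup.center G)).toAdd = 0 → x ^ 2 = 1 := by
    intro x hx
    rw [← hq, hx, ofAdd_zero, map_one]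
    rfl
  intro x
  by_cases hx : (eV (x : G ⧸ Subgroup.center G)).toAdd = 0
  · exact ⟨x, 1, hsq x (by rw [hx, QuadraticMap.map_zero]), one_pow 2, (mul_one x).symm⟩
  · obtain ⟨a, ha⟩ := table_spec.1 _ hx
    obtain ⟨-, h1, h2⟩ := table_spec.2 _ _ ha
    obtain ⟨g, hg⟩ := QuotientGroup.mk_surjective (eV.symm (.ofAdd a))
    have hg' : eV (g : G ⧸ Subgroup.center G) = .ofAdd a := by rw [hg, eV.apply_symm_apply]
    refine ⟨g, g⁻¹ * x, hsq g (by rw [hg']; exact h1), hsq _ ?_, (mul_inv_cancel_left g x).symm⟩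
    -- The factor g⁻¹x lies above -a + v, the negative of a - v, where q has the same value.
    rw [QuotientGroup.mk_mul, QuotientGroup.mk_inv, map_mul, map_inv, hg', toAdd_mul, toAdd_inv,
      toAdd_ofAdd, ← QuadraticMap.map_neg, neg_add, neg_neg, ← sub_eq_add_neg]
    exact h2

/-- The coefficients are natural numbers so that they can serve as exponents of group elements lying
above the four vectors. -/
theorem eq_substitution_combination (v : Fin 4 → ZMod 2) : ∃ a b c d : Fin 2,
    v = a.val • ![1, 0, 1, 0] + b.val • ![1, 1, 0, 0] + c.val • ![0, 1, 1, 1]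
      + d.val • ![1, 0, 0, 1] := by
  revert v
  decide

/-- Operators of a representation whose squares are given by the transfer of `q`. -/
theorem isQuaternionSplit_of_sq {A : Type*} [Ring A] (π : G →* Multiplicative (Fin 4 → ZMod 2))
    (f : G →* A)
    (hf : ∀ x, f x * f x = sign (.ofAdd (transfer sMap qMap (π x).toAdd)) • (1 : A)) {i j y z : G}
    (hi : π i = .ofAdd ![1, 0, 1, 0]) (hj : π j = .ofAdd ![1, 1, 0, 0])
    (hy : π y = .ofAdd ![0, 1, 1, 1]) (hz : π z = .ofAdd ![1, 0, 0, 1]) :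
    IsQuaternionSplit (f i) (f j) (f y) (f z) := by
  have hc := map_mul_eq_sign_smul π f hf
  have pos : ∀ c : ZMod 2, c = 0 → ∀ a : A, sign (.ofAdd c) • a = a := by
    rintro _ rfl a
    rw [ofAdd_zero, map_one, one_smul]
  have neg : ∀ c : ZMod 2, c = 1 → ∀ a : A, sign (.ofAdd c) • a = -a := by
    rintro _ rfl a
    rw [show sign (.ofAdd 1) = -1 from rfl, Units.neg_smul, one_smul]
  constructor
  · exact (hf i).trans (neg _ (by rw [hi]; rfl) _)
  · exact (hf j).trans (neg _ (by rw [hj]; rfl) _)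
  · exact (hf y).trans (pos _ (by rw [hy]; rfl) _)
  · exact (hf z).trans (pos _ (by rw [hz]; rfl) _)
  · exact (hc i j).trans (neg _ (by rw [hi, hj]; rfl) _)
  · exact (hc y z).trans (neg _ (by rw [hy, hz]; rfl) _)
  · exact (hc i y).trans (pos _ (by rw [hi, hy]; rfl) _)
  · exact (hc i z).trans (pos _ (by rw [hi, hz]; rfl) _)
  · exact (hc j y).trans (pos _ (by rw [hj, hy]; rfl) _)
  · exact (hc j z).trans (pos _ (by rw [hj, hz]; rfl) _)

/-- A representation realizable over the reals in which the quaternionic relations hold has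
dimension at least eight. -/
theorem eight_le_of_isRealizableOverReal {E : Type*} [AddCommGroup E] [Module ℂ E] [Nontrivial E]
    {ρ : Representation ℂ G E} (hρ : IsRealizableOverReal ρ) {i j y z : G}
    (h : IsQuaternionSplit (ρ i) (ρ j) (ρ y) (ρ z)) : 8 ≤ Module.finrank ℂ E := by
  obtain ⟨n, b, hb⟩ := hρ
  rw [Module.finrank_eq_card_basis b, Fintype.card_fin]
  choose r hr using hb
  let R : G → Matrix (Fin n) (Fin n) ℝ := fun g => Matrix.of (r g)
  have hR : ∀ g, LinearMap.toMatrixAlgEquiv b (ρ g) = (algebraMap ℝ ℂ).mapMatrix (R g) := by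
    intro g
    ext k l
    exact hr g k l
  -- The relations pass to complex matrices, descend to the real ones because extension of scalars
  -- is injective on matrices, and then act on ℝⁿ.
  have h1 := h.map (LinearMap.toMatrixAlgEquiv b : Module.End ℂ E →+* Matrix (Fin n) (Fin n) ℂ)
  simp only [RingHom.coe_coe, hR] at h1
  have h2 := (h1.of_injective _ (Matrix.map_injective (algebraMap ℝ ℂ).injective)).map
    (Matrix.toLinAlgEquiv' (R := ℝ) (n := Fin n)).toRingEquiv.toRingHom
  have : Nonempty (Fin n) := b.index_nonempty
  simpa using h2.eight_le_finrank

theorem not_isTotallyOrthogonal_of_isSpecialTwoGroupOf (h : IsSpecialTwoGroupOf G qMap) :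
    ¬ IsTotallyOrthogonal G := by
  rintro ⟨-, hreal⟩
  obtain ⟨hG, eV, eW, hq⟩ := h
  have := hG.finite
  let π : G →* Multiplicative (Fin 4 → ZMod 2) :=
    eV.toMonoidHom.comp (QuotientGroup.mk' (Subgroup.center G))
  let χ : Subgroup.center G →* ℤˣ :=
    sign.comp ((AddMonoidHom.toMultiplicative sMap.toAddMonoidHom).comp eW.symm.toMonoidHom)
  obtain ⟨n, ρ, hirr, hρ⟩ := exists_irreducible_of_centralCharacter χ
  have hnt : Nontrivial (Fin n → ℂ) := by
    by_contra hsub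
    rw [not_nontrivial_iff_subsingleton] at hsub
    obtain ⟨p, p', hp⟩ := hirr.exists_pair_ne
    exact hp (Subrepresentation.toSubmodule_injective (Subsingleton.elim _ _))
  -- The element x² is central and corresponds to q(π x), so ρ acts on it by the sign of s(q(π x)).
  have hsq : ∀ x, ρ x * ρ x = sign (.ofAdd (transfer sMap qMap (π x).toAdd)) • 1 := by
    intro x
    rw [← map_mul, ← pow_two, ← hq x, hρ]
    simp only [χ, MonoidHom.comp_apply, MulEquiv.toMonoidHom_eq_coe, MonoidHom.coe_coe,
      MulEquiv.symm_apply_apply, Units.smul_def, zsmul_one]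
    rfl
  have hsurj : Function.Surjective π := eV.surjective.comp (QuotientGroup.mk'_surjective _)
  have hker : ∀ x, π x = 1 → x ∈ Subgroup.center G := by
    intro x hx
    rw [← QuotientGroup.eq_one_iff]
    exact (map_eq_one_iff eV eV.injective).1 hx
  -- The four vectors are the columns of `substitution`: i, j lie above the plane [1,1] and y, z
  -- above [0,0].
  obtain ⟨i, hi⟩ := hsurj (.ofAdd ![1, 0, 1, 0])
  obtain ⟨j, hj⟩ := hsurj (.ofAdd ![1, 1, 0, 0])
  obtain ⟨y, hy⟩ := hsurj (.ofAdd ![0, 1, 1, 1])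
  obtain ⟨z, hz⟩ := hsurj (.ofAdd ![1, 0, 0, 1])
  have hquat := isQuaternionSplit_of_sq π ρ hsq hi hj hy hz
  obtain ⟨S, hS, hdim, hSi, hSj, hSy, hSz⟩ := hquat.exists_invariant_submodule
  let stab : Submonoid G :=
    { carrier := {g | ∀ v ∈ S, ρ g v ∈ S}
      one_mem' := fun v hv => by rwa [map_one]
      mul_mem' := fun {g g'} hg hg' v hv => by
        rw [map_mul]
        exact hg _ (hg' _ hv) }
  -- Modulo the centre every g is a word in i, j, y, z, and the centre acts by signs; so S is
  -- G-stable, and irreducibility makes it the whole space.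
  have hstab : ∀ g, g ∈ stab := by
    intro g
    obtain ⟨a, b, c, d, hv⟩ := eq_substitution_combination (π g).toAdd
    let k := i ^ a.val * j ^ b.val * y ^ c.val * z ^ d.val
    have hk : k ∈ stab :=
      mul_mem (mul_mem (mul_mem (pow_mem (show i ∈ stab from hSi) _)
        (pow_mem (show j ∈ stab from hSj) _)) (pow_mem (show y ∈ stab from hSy) _))
        (pow_mem (show z ∈ stab from hSz) _)
    have hπ : π k = π g := by
      simp only [k, map_mul, map_pow, hi, hj, hy, hz]
      exact congrArg Multiplicative.ofAdd hv.symm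
    have hc : k⁻¹ * g ∈ Subgroup.center G := hker _ (by rw [map_mul, map_inv, hπ, inv_mul_cancel])
    rw [← mul_inv_cancel_left k g]
    refine mul_mem hk fun v hv => ?_
    rw [show ρ (k⁻¹ * g) = _ from hρ ⟨_, hc⟩, Module.End.intCast_apply]
    exact S.toAddSubgroup.zsmul_mem hv _
  let p : Subrepresentation ρ := ⟨S, fun g v hv => hstab g v hv⟩
  have hp : p = ⊤ := (hirr.eq_bot_or_eq_top p).resolve_left fun h0 =>
    hS (congrArg Subrepresentation.toSubmodule h0)
  have hStop : S = ⊤ := congrArg Subrepresentation.toSubmodule hp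
  have h4 : Module.finrank ℂ (Fin n → ℂ) ≤ 4 := by
    rwa [hStop, finrank_top] at hdim
  refine hreal n ρ ⟨hirr, fun hR => ?_⟩
  have h8 := eight_le_of_isRealizableOverReal hR hquat
  omega

/-! ### A symplectic basis for [1,1] ⊥ [0,0] and the resulting Arf invariants. -/

/-- The basis `w, y; x, z` of the substitution. -/
noncomputable def substitutionBasis :
    Module.Basis (Fin 2 ⊕ Fin 2) (ZMod 2) ((ZMod 2 × ZMod 2) × (ZMod 2 × ZMod 2)) :=
  Module.Basis.ofEquivFun
    { toFun := fun p => Sum.elim ![p.1.1, p.2.1] ![p.1.2, p.2.2]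
      invFun := fun c => ((c (.inl 0), c (.inr 0)), (c (.inl 1), c (.inr 1)))
      map_add' := fun p p' => by ext (k | k) <;> fin_cases k <;> rfl
      map_smul' := fun a p => by ext (k | k) <;> fin_cases k <;> rfl
      left_inv := fun p => rfl
      right_inv := fun c => by ext (k | k) <;> fin_cases k <;> rfl }

theorem isSymplecticBasis_substitutionBasis :
    IsSymplecticBasis ((binaryForm (1 : ZMod 2) 1).prod (binaryForm (0 : ZMod 2) 0))
      substitutionBasis := by
  intro k l
  simp only [substitutionBasis, Module.Basis.coe_ofEquivFun, QuadraticMap.polar,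
    QuadraticMap.prod_apply, binaryForm]
  fin_cases k <;> fin_cases l <;> simp <;> decide

theorem isSymplecticBasis_map {V V' : Type*} [AddCommGroup V] [Module (ZMod 2) V]
    [AddCommGroup V'] [Module (ZMod 2) V'] {Q : QuadraticForm (ZMod 2) V}
    {Q' : QuadraticForm (ZMod 2) V'} (e : Q.IsometryEquiv Q') {n : ℕ}
    {b : Module.Basis (Fin n ⊕ Fin n) (ZMod 2) V} (hb : IsSymplecticBasis Q b) :
    IsSymplecticBasis Q' (b.map e.toLinearEquiv) := by
  have hpolar : ∀ u v, QuadraticMap.polar Q' (e.toLinearEquiv u) (e.toLinearEquiv v) =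
      QuadraticMap.polar Q u v := by
    intro u v
    simp only [QuadraticMap.polar, ← map_add]
    exact congrArg₂ _ (congrArg₂ _ (e.map_app _) (e.map_app _)) (e.map_app _)
  intro k l
  simpa only [Module.Basis.map_apply, hpolar] using hb k l

theorem arfInvariant_transfer_ne_zero : arfInvariant (transfer sMap qMap) ≠ 0 :=
  arfInvariant_ne_zero _
    (isSymplecticBasis_map substitutionIsometry isSymplecticBasis_substitutionBasis)
    card_zeros_transfer

theorem arfInvariant_binaryForm_prod_ne_zero :
    arfInvariant ((binaryForm (1 : ZMod 2) 1).prod (binaryForm (0 : ZMod 2) 0)) ≠ 0 := by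
  refine arfInvariant_ne_zero _ isSymplecticBasis_substitutionBasis ?_
  rw [← card_zeros_transfer]
  exact Nat.card_congr (substitutionIsometry.toLinearEquiv.toEquiv.subtypeEquiv fun p => by
    rw [← substitutionIsometry.map_app p]; rfl)

end SpecialTwoGroups

theorem mainTheorem5 :
    -- `q` is regular and the image of its polar map generates `W`
    (SpecialTwoGroups.IsRegular SpecialTwoGroups.qMap ∧
      AddSubgroup.closure {c | ∃ v u, QuadraticMap.polar SpecialTwoGroups.qMap v u = c} = ⊤) ∧
    -- the special `2`-group of `q` exists, has order 64, is strongly real, not totally orthogonal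
    (∃ (G : Type) (_ : Group G), SpecialTwoGroups.IsSpecialTwoGroupOf G SpecialTwoGroups.qMap) ∧
    (∀ (G : Type u) [Group G], SpecialTwoGroups.IsSpecialTwoGroupOf G SpecialTwoGroups.qMap →
      Nat.card G = 64 ∧ SpecialTwoGroups.IsStronglyReal G ∧
        ¬ SpecialTwoGroups.IsTotallyOrthogonal G) ∧
    -- the table: for every nonzero `v` it lists an `a ≠ v` with `q(a) = q(a - v) = 0`
    ((∀ v : Fin 4 → ZMod 2, v ≠ 0 → ∃ a, (v, a) ∈ SpecialTwoGroups.table) ∧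
      ∀ v a, (v, a) ∈ SpecialTwoGroups.table →
        v ≠ a ∧ SpecialTwoGroups.qMap a = 0 ∧ SpecialTwoGroups.qMap (a - v) = 0) ∧
    -- the transfer `s_*(q)` is regular, equal to `q_s`, and isometric to `[1,1] ⊥ [0,0]`
    -- through the displayed change of variables
    ((∀ w x y z : ZMod 2,
        SpecialTwoGroups.transfer SpecialTwoGroups.sMap SpecialTwoGroups.qMap ![w, x, y, z] =
          z ^ 2 + w * x + w * z + x * y + w * y) ∧
      SpecialTwoGroups.IsRegular
        (SpecialTwoGroups.transfer SpecialTwoGroups.sMap SpecialTwoGroups.qMap) ∧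
      (∃ h : LinearMap.ker (QuadraticMap.polarBilin
            (SpecialTwoGroups.transfer SpecialTwoGroups.sMap SpecialTwoGroups.qMap)) ≤
          (SpecialTwoGroups.transfer SpecialTwoGroups.sMap SpecialTwoGroups.qMap).radical,
        QuadraticMap.Equivalent
          (SpecialTwoGroups.transfer SpecialTwoGroups.sMap SpecialTwoGroups.qMap)
          (SpecialTwoGroups.inducedForm
            (SpecialTwoGroups.transfer SpecialTwoGroups.sMap SpecialTwoGroups.qMap) h)) ∧
      (∀ w x y z : ZMod 2,
        SpecialTwoGroups.transfer SpecialTwoGroups.sMap SpecialTwoGroups.qMap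
            ![w + x + z, x + y, y + w, y + z] =
          ((SpecialTwoGroups.binaryForm (1 : ZMod 2) 1).prod
            (SpecialTwoGroups.binaryForm (0 : ZMod 2) 0)) ((w, x), (y, z))) ∧
      QuadraticMap.Equivalent
        (SpecialTwoGroups.transfer SpecialTwoGroups.sMap SpecialTwoGroups.qMap)
        ((SpecialTwoGroups.binaryForm (1 : ZMod 2) 1).prod
          (SpecialTwoGroups.binaryForm (0 : ZMod 2) 0))) ∧
    -- the Arf invariant of `[1,1] ⊥ [0,0]`, hence of the transfer, is nontrivial
    (SpecialTwoGroups.arfInvariant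
        ((SpecialTwoGroups.binaryForm (1 : ZMod 2) 1).prod
          (SpecialTwoGroups.binaryForm (0 : ZMod 2) 0)) ≠ 0 ∧
      SpecialTwoGroups.arfInvariant
        (SpecialTwoGroups.transfer SpecialTwoGroups.sMap SpecialTwoGroups.qMap) ≠ 0) := by
  open SpecialTwoGroups in
  exact ⟨⟨isRegular_qMap, closure_polar_qMap⟩,
    exists_isSpecialTwoGroupOf isRegular_qMap closure_polar_qMap,
    fun G _ h => ⟨card_of_isSpecialTwoGroupOf h, isStronglyReal_of_isSpecialTwoGroupOf h,
      not_isTotallyOrthogonal_of_isSpecialTwoGroupOf h⟩,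
    table_spec,
    ⟨transfer_apply, isRegular_transfer,
      ⟨((isRegular_iff_ker_eq_bot _).1 isRegular_transfer).trans_le bot_le,
        equivalent_inducedForm isRegular_transfer _⟩,
      transfer_substitution, ⟨substitutionIsometry.symm⟩⟩,
    arfInvariant_binaryForm_prod_ne_zero, arfInvariant_transfer_ne_zero⟩
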